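/- Let $\mathscr{V}_1$ be the collection of all bounded operators $V$ on separable complex Hilbert spaces $\mathcal{H}_V$ such that (i) $V$ is a partial isometry, i.e. $V|_{(\ker V)^\perp}$ is isometric; (ii) $\dim \ker V = \dim (\operatorname{ran} V)^\perp = 1$; (iii) $V$ is completely non-unitary, i.e. there is no nonzero closed subspace that is invariant under $V$ and $V^*$ and on which $V$ is unitary. For $A, B \in \mathscr{V}_1$ write $A \preccurlyeq_q B$ if there is an injective bounded linear operator $X : \mathcal{H}_A \to \mathcal{H}_B$ such that $X (\ker A)^\perp \subset (\ker B)^\perp$ and $X A x = B X x$ for all $x \in (\ker A)^\perp$, and write $A \sim_q B$ if $A \preccurlyeq_q B$ and $B \preccurlyeq_q A$. The pre-order $\preccurlyeq_q$ induces a partial order, also denoted $\preccurlyeq_q$, on the set $\mathscr{V}_1/\!\sim_q$ of equivalence classes $[V]_q$. Let $S f = z f$ be the unilateral shift on the Hardy space $H^2$ of the unit disk, and let $A := S^* \oplus S$ on $H^2 \oplus H^2$. **Proposition.** The operator $A$ belongs to $\mathscr{V}_1$, and $[A]_q$ is the unique maximal element of $\mathscr{V}_1/\!\sim_q$ with respect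 to $\preccurlyeq_q$. Moreover, $[V]_q \preccurlyeq_q [A]_q$ for every $V \in \mathscr{V}_1$. -/

import Mathlib

open MeasureTheory
open scoped ENNReal

namespace PartialIsometryOrder

universe u v w

section Operators

variable {H : Type u} [NormedAddCommGroup H] [InnerProductSpace ℂ H]

/-- `V` is a partial isometry: it is isometric on the orthogonal complement of its kernel. -/
def IsPartialIsometry (V : H →L[ℂ] H) : Prop :=
  ∀ x ∈ V.kerᗮ, ‖V x‖ = ‖x‖

/-- The closed subspace `M` reduces `V`: it is invariant under `V` and under its adjoint. -/
def IsReducing [CompleteSpace H] (V : H →L[ℂ] H) (M : Submodule ℂ H) : Prop :=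
  IsClosed (M : Set H) ∧ (∀ x ∈ M, V x ∈ M) ∧ (∀ x ∈ M, ContinuousLinearMap.adjoint V x ∈ M)

/-- `V` restricts to a unitary operator of `M`, that is, to an isometry of `M` onto `M`. -/
def IsUnitaryOn (V : H →L[ℂ] H) (M : Submodule ℂ H) : Prop :=
  (∀ x ∈ M, ‖V x‖ = ‖x‖) ∧ V '' (M : Set H) = M

/-- `V` is completely non-unitary: no nonzero reducing subspace on which `V` is unitary. -/
def IsCompletelyNonUnitary [CompleteSpace H] (V : H →L[ℂ] H) : Prop :=
  ∀ M : Submodule ℂ H, IsReducing V M → IsUnitaryOn V M → M = ⊥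

/-- `V` belongs to `𝒱ₙ(H)`, for finite `n`: `H` is separable and `V` is a completely non-unitary
partial isometry both of whose defect spaces `ker V` and `(ran V)ᗮ` have dimension `n`. -/
structure MemV [CompleteSpace H] (n : ℕ) (V : H →L[ℂ] H) : Prop where
  separable : TopologicalSpace.SeparableSpace H
  partialIsometry : IsPartialIsometry V
  rank_ker : Module.rank ℂ V.ker = n
  rank_range_orthogonal : Module.rank ℂ V.rangeᗮ = n
  completelyNonUnitary : IsCompletelyNonUnitary V

variable {K : Type v} [NormedAddCommGroup K] [InnerProductSpace ℂ K]

/-- The relation `A ≼_q B`: there is a bounded injective linear map `X` that carries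
`(ker A)ᗮ` into `(ker B)ᗮ` and satisfies `X A = B X` on `(ker A)ᗮ`. -/
def PrecQ (A : H →L[ℂ] H) (B : K →L[ℂ] K) : Prop :=
  ∃ X : H →L[ℂ] K, Function.Injective X ∧
    ∀ x ∈ A.kerᗮ, X x ∈ B.kerᗮ ∧ X (A x) = B (X x)

theorem PrecQ.refl (A : H →L[ℂ] H) : PrecQ A A :=
  ⟨ContinuousLinearMap.id ℂ H, fun _ _ h => h, fun _ hx => ⟨hx, rfl⟩⟩

theorem PrecQ.trans {L : Type w} [NormedAddCommGroup L] [InnerProductSpace ℂ L]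
    {A : H →L[ℂ] H} {B : K →L[ℂ] K} {C : L →L[ℂ] L} (h₁ : PrecQ A B) (h₂ : PrecQ B C) :
    PrecQ A C := by
  obtain ⟨X, hX, hX'⟩ := h₁
  obtain ⟨Y, hY, hY'⟩ := h₂
  refine ⟨Y.comp X, hY.comp hX, fun x hx => ?_⟩
  obtain ⟨h3, h4⟩ := hX' x hx
  obtain ⟨h5, h6⟩ := hY' _ h3
  exact ⟨h5, by simp [h4, h6]⟩

end Operators

/-- `𝒱ₙ`: the collection of all members of `𝒱ₙ(H)`, for all Hilbert spaces `H`. -/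
structure V (n : ℕ) : Type (u + 1) where
  space : Type u
  [normed : NormedAddCommGroup space]
  [inner : InnerProductSpace ℂ space]
  [complete : CompleteSpace space]
  op : space →L[ℂ] space
  mem : MemV n op

attribute [instance] V.normed V.inner V.complete

/-- The pre-order `≼_q` on `𝒱ₙ`. -/
instance (n : ℕ) : Preorder (V.{u} n) where
  le A B := PrecQ A.op B.op
  le_refl A := PrecQ.refl A.op
  le_trans _ _ _ := PrecQ.trans

/-- The quotient `𝒱ₙ/∼_q`, where `A ∼_q B` means `A ≼_q B` and `B ≼_q A`; it carries the partial
order induced by `≼_q`. -/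
abbrev VModQ (n : ℕ) : Type (u + 1) := Antisymmetrization (V.{u} n) (· ≤ ·)

/-- The class `[A]_q`. -/
def classQ {n : ℕ} (A : V.{u} n) : VModQ.{u} n := toAntisymmetrization (· ≤ ·) A

noncomputable section Hardy

/-- `L²` of the unit circle with normalized arc length; the circle is parametrized by
`t ↦ exp (2πit)`, `t ∈ ℝ/ℤ`, so that `fourier n t` is `zⁿ` at the point `z = exp (2πit)`. -/
abbrev L2Circle : Type := Lp ℂ 2 (AddCircle.haarAddCircle (T := 1))

theorem fourierCoeff_eq_inner (f : L2Circle) (n : ℤ) :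
    fourierCoeff (f : UnitAddCircle → ℂ) n = inner ℂ (fourierLp 2 n) f := by
  rw [← fourierBasis_repr, HilbertBasis.repr_apply_apply, coe_fourierBasis]

/-- The Hardy space `H²`: the functions in `L²` of the circle whose Fourier coefficients of
negative index vanish. -/
def H2 : Submodule ℂ L2Circle where
  carrier := {f | ∀ n : ℤ, n < 0 → fourierCoeff (f : UnitAddCircle → ℂ) n = 0}
  zero_mem' n _ := by rw [fourierCoeff_eq_inner, inner_zero_right]
  add_mem' {f g} hf hg n hn := by
    have h1 := hf n hn
    have h2 := hg n hn
    rw [fourierCoeff_eq_inner] at h1 h2 ⊢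
    simp [inner_add_right, h1, h2]
  smul_mem' c f hf n hn := by
    have h1 := hf n hn
    rw [fourierCoeff_eq_inner] at h1 ⊢
    simp [inner_smul_right, h1]

theorem isClosed_H2 : IsClosed (H2 : Set L2Circle) := by
  have : (H2 : Set L2Circle) =
      ⋂ n : ℤ, ⋂ _ : n < 0, {f : L2Circle | inner ℂ (fourierLp 2 n) f = 0} := by
    ext f
    simp only [Set.mem_iInter, Set.mem_ofPred_eq, ← fourierCoeff_eq_inner]
    rfl
  rw [this]
  exact isClosed_iInter fun n => isClosed_iInter fun _ =>
    isClosed_eq (by fun_prop) continuous_const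

instance : CompleteSpace H2 := isClosed_H2.completeSpace_coe

/-- Multiplication by `z` on `L²` of the circle. -/
def mulZ : L2Circle →L[ℂ] L2Circle :=
  (ContinuousLinearMap.lsmul ℂ ℂ).holderL AddCircle.haarAddCircle ∞ 2 2 (fourierLp ∞ 1)

theorem coeFn_mulZ (f : L2Circle) :
    (mulZ f : UnitAddCircle → ℂ) =ᵐ[AddCircle.haarAddCircle] fun t => fourier 1 t * f t := by
  have h1 := ContinuousLinearMap.coeFn_holder (r := 2) (ContinuousLinearMap.lsmul ℂ ℂ)
    (fourierLp (T := 1) ∞ 1) f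
  have h2 := coeFn_fourierLp (T := 1) ∞ 1
  filter_upwards [h1, h2] with t h1 h2
  refine h1.trans ?_
  rw [h2]
  rfl

theorem fourierCoeff_mulZ (f : L2Circle) (n : ℤ) :
    fourierCoeff (mulZ f : UnitAddCircle → ℂ) n =
      fourierCoeff (f : UnitAddCircle → ℂ) (n - 1) := by
  unfold fourierCoeff
  refine integral_congr_ae ?_
  filter_upwards [coeFn_mulZ f] with t ht
  rw [ht, show -(n - 1) = -n + 1 by ring, fourier_add]
  simp [mul_assoc]

/-- The unilateral shift `S f = z f` on `H²`. -/
def shift : H2 →L[ℂ] H2 :=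
  (mulZ.comp H2.subtypeL).codRestrict H2 fun f n hn => by
    have := f.2 (n - 1) (by omega)
    simpa [fourierCoeff_mulZ] using this

/-- The Hilbert space direct sum `H² ⊕ H²`. -/
abbrev H2sum : Type := WithLp 2 (H2 × H2)

/-- The operator `S* ⊕ S` on `H² ⊕ H²`, `(f, g) ↦ (S* f, S g)`. -/
def shiftSum : H2sum →L[ℂ] H2sum :=
  (WithLp.prodContinuousLinearEquiv 2 ℂ H2 H2).symm.toContinuousLinearMap ∘L
    (ContinuousLinearMap.adjoint shift).prodMap shift ∘L
      (WithLp.prodContinuousLinearEquiv 2 ℂ H2 H2).toContinuousLinearMap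

end Hardy

end PartialIsometryOrder

/-!
The idea is to write down the intertwiner explicitly. Let `T` be in `𝒱₁`, and let `u`, `w` be unit
vectors spanning `ker T` and `ker T* = (ran T)ᗮ`. To `f` assign the pair of power series

  `∑ ⟪u, Tⁿ f⟫ zⁿ`  and  `∑ ⟪w, T*ⁿ f⟫ zⁿ`.

Since `‖T g‖² + |⟪u, g⟫|² ≤ ‖g‖²`, the coefficients are square summable
(`exists_clm_hardyBasis_repr_eq`), so that the pair lies in `H² ⊕ H²` and depends boundedly on `f`.
If `f ⊥ ker T`, the constant term of the first series vanishes, that is, the pair is orthogonal to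
`ker (S* ⊕ S)`. Replacing such an `f` by `T f` shifts the first series backwards, and shifts the
second one forwards because `T* T f = f` and `⟪w, T f⟫ = 0`. The map is
injective: the vectors on which both series vanish form a reducing subspace on which `T` is
unitary (`eq_zero_of_forall_pow_mem_ker_orthogonal`), and that is zero as `T` is completely
non-unitary.
This gives `prec_shiftSum`, so the class of `S* ⊕ S` is the largest one.

That `S* ⊕ S` is itself in `𝒱₁` (`memV_shiftSum`) is read off from the Taylor coefficients, the
coordinates with respect to the Hilbert basis `hardyBasis` of monomials.
-/

namespace PartialIsometryOrder

open ContinuousLinearMap InnerProductSpace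

/-! ### Partial isometries -/

section Operators

variable {H : Type*} [NormedAddCommGroup H] [InnerProductSpace ℂ H]

theorem pow_succ_apply (T : H →L[ℂ] H) (n : ℕ) (x : H) : (T ^ (n + 1)) x = (T ^ n) (T x) := rfl

theorem pow_succ_apply' (T : H →L[ℂ] H) (n : ℕ) (x : H) : (T ^ (n + 1)) x = T ((T ^ n) x) := by
  rw [pow_succ']
  rfl

variable {T : H →L[ℂ] H}

theorem sum_norm_inner_pow_sq_le (hT : ‖T‖ ≤ 1) {u : H} (hu : ‖u‖ = 1) (hTu : T u = 0) (x : H)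
    (n : ℕ) : ∑ k ∈ Finset.range n, ‖⟪u, (T ^ k) x⟫_ℂ‖ ^ 2 + ‖(T ^ n) x‖ ^ 2 ≤ ‖x‖ ^ 2 := by
  -- Only the component of `y` orthogonal to `u` contributes to `T y`; the bound then telescopes.
  have step (y : H) : ‖⟪u, y⟫_ℂ‖ ^ 2 + ‖T y‖ ^ 2 ≤ ‖y‖ ^ 2 := by
    set c := ⟪u, y⟫_ℂ with hc
    have horth : ⟪c • u, y - c • u⟫_ℂ = 0 := by
      rw [inner_smul_left, inner_sub_right, inner_smul_right, ← hc, inner_self_eq_norm_sq_to_K, hu]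
      simp
    have hpyth := norm_add_sq_eq_norm_sq_add_norm_sq_of_inner_eq_zero _ _ horth
    rw [add_sub_cancel, norm_smul, hu, mul_one] at hpyth
    have hle : ‖T y‖ ≤ ‖y - c • u‖ := by
      have : T y = T (y - c • u) := by simp [hTu]
      rw [this]
      exact (T.le_of_opNorm_le hT _).trans_eq (one_mul _)
    nlinarith [norm_nonneg (T y)]
  induction n with
  | zero => simp
  | succ n ih =>
    have h := step ((T ^ n) x)
    rw [Finset.sum_range_succ, pow_succ_apply']
    linarith

variable [CompleteSpace H]

theorem IsPartialIsometry.norm_apply_le (hT : IsPartialIsometry T) (x : H) : ‖T x‖ ≤ ‖x‖ := by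
  have : CompleteSpace T.ker := T.isClosed_ker.completeSpace_coe
  obtain ⟨y, hy, z, hz, rfl⟩ := T.ker.exists_add_mem_mem_orthogonal x
  have hy0 : T y = 0 := hy
  have hpyth := norm_add_sq_eq_norm_sq_add_norm_sq_of_inner_eq_zero y z
    (Submodule.inner_right_of_mem_orthogonal hy hz)
  rw [map_add, hy0, zero_add, hT z hz]
  nlinarith [norm_nonneg z, norm_nonneg (y + z), mul_self_nonneg ‖y‖]

theorem IsPartialIsometry.norm_le_one (hT : IsPartialIsometry T) : ‖T‖ ≤ 1 :=
  T.opNorm_le_bound zero_le_one fun x => by simpa using hT.norm_apply_le x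

theorem IsPartialIsometry.adjoint_apply_apply (hT : IsPartialIsometry T) {x : H}
    (hx : x ∈ T.kerᗮ) : adjoint T (T x) = x := by
  have : CompleteSpace T.ker := T.isClosed_ker.completeSpace_coe
  refine ext_inner_right ℂ fun y => ?_
  rw [adjoint_inner_left]
  obtain ⟨a, ha, b, hb, rfl⟩ := T.ker.exists_add_mem_mem_orthogonal y
  have ha0 : T a = 0 := ha
  -- Polarization: the restriction of `T` to `(ker T)ᗮ` preserves inner products.
  let L : T.kerᗮ →ₗᵢ[ℂ] H := ⟨T.toLinearMap ∘ₗ T.kerᗮ.subtype, fun z => hT z z.2⟩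
  have hL : ⟪T x, T b⟫_ℂ = ⟪x, b⟫_ℂ := L.inner_map_map ⟨x, hx⟩ ⟨b, hb⟩
  rw [map_add, ha0, zero_add, inner_add_right, hL,
    Submodule.inner_left_of_mem_orthogonal ha hx, zero_add]

theorem IsPartialIsometry.apply_adjoint_apply_apply (hT : IsPartialIsometry T) (x : H) :
    T (adjoint T (T x)) = T x := by
  have : CompleteSpace T.ker := T.isClosed_ker.completeSpace_coe
  obtain ⟨a, ha, b, hb, rfl⟩ := T.ker.exists_add_mem_mem_orthogonal x
  have ha0 : T a = 0 := ha
  rw [map_add, ha0, zero_add, hT.adjoint_apply_apply hb]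

theorem IsPartialIsometry.apply_adjoint_apply (hT : IsPartialIsometry T) {x : H}
    (hx : x ∈ (adjoint T).kerᗮ) : T (adjoint T x) = x := by
  -- The difference of the two sides is both in `ker T*` and orthogonal to it.
  have hker : T (adjoint T x) - x ∈ (adjoint T).ker := by
    change adjoint T (T (adjoint T x) - x) = 0
    refine ext_inner_right ℂ fun y => ?_
    rw [map_sub, inner_sub_left, adjoint_inner_left, ← adjoint_inner_right,
      adjoint_inner_left, hT.apply_adjoint_apply_apply, ← adjoint_inner_left T, sub_self,
      inner_zero_left]
  have horth : T (adjoint T x) - x ∈ (adjoint T).kerᗮ := by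
    refine Submodule.sub_mem _ (fun y hy => ?_) hx
    have hy0 : adjoint T y = 0 := hy
    rw [← adjoint_inner_left, hy0, inner_zero_left]
  exact sub_eq_zero.1 ((Submodule.inf_orthogonal_eq_bot _).le ⟨hker, horth⟩)

/-- The vectors whose forward orbit avoids `ker T` and whose backward orbit avoids `ker T*` form
the unitary part of a partial isometry `T`, which is zero if `T` is completely non-unitary. -/
theorem eq_zero_of_forall_pow_mem_ker_orthogonal (hT : IsPartialIsometry T)
    (hcnu : IsCompletelyNonUnitary T) {x : H} (h : ∀ n : ℕ, (T ^ n) x ∈ T.kerᗮ)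
    (h' : ∀ n : ℕ, (adjoint T ^ n) x ∈ (adjoint T).kerᗮ) : x = 0 := by
  let M : Submodule ℂ H := (⨅ n : ℕ, T.kerᗮ.comap (T ^ n).toLinearMap) ⊓
    ⨅ n : ℕ, (adjoint T).kerᗮ.comap (adjoint T ^ n).toLinearMap
  have hM (y : H) : y ∈ M ↔ (∀ n : ℕ, (T ^ n) y ∈ T.kerᗮ) ∧
      ∀ n : ℕ, (adjoint T ^ n) y ∈ (adjoint T).kerᗮ := by
    simp only [M, Submodule.mem_inf, Submodule.mem_iInf, Submodule.mem_comap, coe_coe]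
  have hmem : ∀ y ∈ M, T y ∈ M := by
    intro y hy
    obtain ⟨h1, h2⟩ := (hM y).1 hy
    refine (hM _).2 ⟨fun n => h1 (n + 1), fun n => ?_⟩
    cases n with
    | zero =>
      intro z hz
      have hz0 : adjoint T z = 0 := hz
      change ⟪z, T y⟫_ℂ = 0
      rw [← adjoint_inner_left, hz0, inner_zero_left]
    | succ n =>
      have : (adjoint T ^ (n + 1)) (T y) = (adjoint T ^ n) y := by
        rw [pow_succ_apply, hT.adjoint_apply_apply (x := y) (h1 0)]
      rw [this]
      exact h2 n
  have hmem' : ∀ y ∈ M, adjoint T y ∈ M := by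
    intro y hy
    obtain ⟨h1, h2⟩ := (hM y).1 hy
    refine (hM _).2 ⟨fun n => ?_, fun n => h2 (n + 1)⟩
    cases n with
    | zero =>
      intro z hz
      have hz0 : T z = 0 := hz
      change ⟪z, adjoint T y⟫_ℂ = 0
      rw [adjoint_inner_right, hz0, inner_zero_left]
    | succ n =>
      have : (T ^ (n + 1)) (adjoint T y) = (T ^ n) y := by
        rw [pow_succ_apply, hT.apply_adjoint_apply (x := y) (h2 0)]
      rw [this]
      exact h1 n
  have hclosed : IsClosed (M : Set H) := by
    have : (M : Set H) = (⋂ n : ℕ, (T ^ n) ⁻¹' (T.kerᗮ : Set H)) ∩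
        ⋂ n : ℕ, (adjoint T ^ n) ⁻¹' ((adjoint T).kerᗮ : Set H) := by
      ext y
      simp [hM]
    rw [this]
    exact (isClosed_iInter fun n => (Submodule.isClosed_orthogonal _).preimage (T ^ n).continuous)
      |>.inter (isClosed_iInter fun n =>
        (Submodule.isClosed_orthogonal _).preimage (adjoint T ^ n).continuous)
  have hbot : M = ⊥ := by
    refine hcnu M ⟨hclosed, hmem, hmem'⟩ ⟨fun y hy => hT y (((hM y).1 hy).1 0), ?_⟩
    refine Set.Subset.antisymm (Set.image_subset_iff.2 hmem) fun y hy => ?_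
    exact ⟨adjoint T y, hmem' y hy, hT.apply_adjoint_apply (((hM y).1 hy).2 0)⟩
  have hx : x ∈ M := (hM x).2 ⟨h, h'⟩
  rwa [hbot] at hx

theorem range_orthogonal_eq_ker_adjoint (T : H →L[ℂ] H) : T.rangeᗮ = (adjoint T).ker := by
  ext y
  change (∀ z ∈ T.range, ⟪z, y⟫_ℂ = 0) ↔ adjoint T y = 0
  constructor
  · intro h
    refine ext_inner_left ℂ fun x => ?_
    rw [adjoint_inner_right, inner_zero_right]
    exact h _ ⟨x, rfl⟩
  · rintro h _ ⟨x, rfl⟩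
    change ⟪T x, y⟫_ℂ = 0
    rw [← adjoint_inner_right, h, inner_zero_right]

theorem exists_norm_eq_one_span_singleton_of_rank_eq_one {E : Type*} [NormedAddCommGroup E]
    [InnerProductSpace ℂ E] {N : Submodule ℂ E} (h : Module.rank ℂ N = 1) :
    ∃ u : E, ‖u‖ = 1 ∧ N = ℂ ∙ u := by
  obtain ⟨v, hv, hv0, hle⟩ := rank_submodule_eq_one_iff N |>.1 h
  have hN : N = ℂ ∙ v := le_antisymm hle ((Submodule.span_singleton_le_iff_mem _ _).2 hv)
  have hnorm : (‖v‖ : ℂ) ≠ 0 := by simpa using hv0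
  refine ⟨(‖v‖ : ℂ)⁻¹ • v, by simp [norm_smul, hv0], ?_⟩
  rw [hN, Submodule.span_singleton_smul_eq (inv_ne_zero hnorm).isUnit]

end Operators

noncomputable section

/-! ### The monomial basis of the Hardy space -/

/-- The monomial `zⁿ` as an element of `H²`. -/
def monomialH2 (n : ℕ) : H2 :=
  ⟨fourierLp 2 n, fun m hm => by
    rw [fourierCoeff_eq_inner]
    exact orthonormal_fourier.2 (by omega)⟩

theorem orthonormal_monomialH2 : Orthonormal ℂ monomialH2 := by
  have h := (orthonormal_fourier (T := 1)).comp (fun n : ℕ => (n : ℤ)) Nat.cast_injective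
  exact ⟨fun n => h.1 n, fun _ _ hmn => h.2 hmn⟩

theorem inner_monomialH2 (n : ℕ) (f : H2) :
    ⟪monomialH2 n, f⟫_ℂ = fourierCoeff ((f : L2Circle) : UnitAddCircle → ℂ) n :=
  (fourierCoeff_eq_inner _ _).symm

/-- The Hilbert basis of `H²` formed by the monomials; its coordinates are the Taylor
coefficients. -/
def hardyBasis : HilbertBasis ℕ ℂ H2 :=
  HilbertBasis.mkOfOrthogonalEqBot orthonormal_monomialH2 <| by
    rw [Submodule.eq_bot_iff]
    intro f hf
    have h0 (n : ℕ) : ⟪monomialH2 n, f⟫_ℂ = 0 :=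
      hf _ (Submodule.subset_span (Set.mem_range_self n))
    apply Subtype.ext
    apply fourierBasis.repr.injective
    ext n
    rw [fourierBasis_repr, ZeroMemClass.coe_zero, map_zero, lp.coeFn_zero, Pi.zero_apply]
    rcases lt_or_ge n 0 with hn | hn
    · exact f.2 n hn
    · lift n to ℕ using hn
      rw [← inner_monomialH2, h0]

theorem hardyBasis_apply (n : ℕ) : hardyBasis n = monomialH2 n := by
  simp [hardyBasis]

theorem hardyBasis_repr (f : H2) (n : ℕ) :
    hardyBasis.repr f n = fourierCoeff ((f : L2Circle) : UnitAddCircle → ℂ) n := by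
  rw [HilbertBasis.repr_apply_apply, hardyBasis_apply, inner_monomialH2]

theorem H2_ext {f g : H2} (h : ∀ n, hardyBasis.repr f n = hardyBasis.repr g n) : f = g :=
  hardyBasis.repr.injective (lp.ext (funext h))

theorem hardyBasis_repr_shift_zero (f : H2) : hardyBasis.repr (shift f) 0 = 0 := by
  rw [hardyBasis_repr]
  exact (fourierCoeff_mulZ f 0).trans (f.2 _ (by norm_num))

theorem hardyBasis_repr_shift_succ (f : H2) (n : ℕ) :
    hardyBasis.repr (shift f) (n + 1) = hardyBasis.repr f n := by
  rw [hardyBasis_repr, hardyBasis_repr]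
  refine (fourierCoeff_mulZ f _).trans ?_
  rw [Nat.cast_succ, add_sub_cancel_right]

theorem shift_hardyBasis (n : ℕ) : shift (hardyBasis n) = hardyBasis (n + 1) := by
  refine H2_ext fun m => ?_
  cases m with
  | zero => rw [hardyBasis_repr_shift_zero, HilbertBasis.repr_self]; simp
  | succ m =>
    rw [hardyBasis_repr_shift_succ, HilbertBasis.repr_self, HilbertBasis.repr_self]
    simp [lp.single_apply, Pi.single_apply]

theorem hardyBasis_repr_adjoint_shift (f : H2) (n : ℕ) :
    hardyBasis.repr (adjoint shift f) n = hardyBasis.repr f (n + 1) := by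
  rw [HilbertBasis.repr_apply_apply, HilbertBasis.repr_apply_apply, adjoint_inner_right,
    shift_hardyBasis]

theorem adjoint_shift_shift (f : H2) : adjoint shift (shift f) = f :=
  H2_ext fun n => by rw [hardyBasis_repr_adjoint_shift, hardyBasis_repr_shift_succ]

theorem norm_shift (f : H2) : ‖shift f‖ = ‖f‖ := by
  rw [← sq_eq_sq₀ (norm_nonneg _) (norm_nonneg _), ← Complex.ofReal_inj]
  push_cast
  have h1 := inner_self_eq_norm_sq_to_K (𝕜 := ℂ) (shift f)
  have h2 := inner_self_eq_norm_sq_to_K (𝕜 := ℂ) f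
  rw [← adjoint_inner_right, adjoint_shift_shift] at h1
  exact h1.symm.trans h2

theorem shift_adjoint_shift {f : H2} (hf : hardyBasis.repr f 0 = 0) :
    shift (adjoint shift f) = f :=
  H2_ext fun n => by
    cases n with
    | zero => rw [hardyBasis_repr_shift_zero, hf]
    | succ n => rw [hardyBasis_repr_shift_succ, hardyBasis_repr_adjoint_shift]

theorem norm_adjoint_shift {f : H2} (hf : hardyBasis.repr f 0 = 0) :
    ‖adjoint shift f‖ = ‖f‖ := by
  rw [← norm_shift, shift_adjoint_shift hf]

theorem hardyBasis_repr_zero_of_norm_adjoint_shift {f : H2} (hf : ‖adjoint shift f‖ = ‖f‖) :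
    hardyBasis.repr f 0 = 0 := by
  have hT : ‖adjoint shift‖ ≤ 1 := by
    rw [LinearIsometryEquiv.norm_map]
    exact opNorm_le_bound _ zero_le_one fun g => by rw [norm_shift, one_mul]
  have h0 : adjoint shift (hardyBasis 0) = 0 := H2_ext fun n => by
    rw [hardyBasis_repr_adjoint_shift, HilbertBasis.repr_self]
    simp
  have h := sum_norm_inner_pow_sq_le hT (hardyBasis.orthonormal.1 0) h0 f 1
  rw [HilbertBasis.repr_apply_apply]
  simpa [hf] using h

theorem adjoint_shift_eq_zero_iff {f : H2} :
    adjoint shift f = 0 ↔ f ∈ ℂ ∙ hardyBasis 0 := by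
  rw [Submodule.mem_span_singleton]
  constructor
  · intro h
    refine ⟨hardyBasis.repr f 0, H2_ext fun n => ?_⟩
    rw [map_smul, HilbertBasis.repr_self]
    cases n with
    | zero => simp
    | succ n => simp [← hardyBasis_repr_adjoint_shift, h]
  · rintro ⟨c, rfl⟩
    refine H2_ext fun n => ?_
    rw [hardyBasis_repr_adjoint_shift, map_smul, HilbertBasis.repr_self]
    simp

/-! ### Membership of the model operator -/

theorem shiftSum_fst (x : H2sum) : (shiftSum x).fst = adjoint shift x.fst := rfl

theorem shiftSum_snd (x : H2sum) : (shiftSum x).snd = shift x.snd := rfl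

theorem adjoint_shiftSum_apply (x : H2sum) :
    adjoint shiftSum x = WithLp.toLp 2 (shift x.fst, adjoint shift x.snd) := by
  refine ext_inner_right ℂ fun y => ?_
  rw [adjoint_inner_left, WithLp.prod_inner_apply, WithLp.prod_inner_apply]
  change ⟪x.fst, adjoint shift y.fst⟫_ℂ + ⟪x.snd, shift y.snd⟫_ℂ =
    ⟪shift x.fst, y.fst⟫_ℂ + ⟪adjoint shift x.snd, y.snd⟫_ℂ
  rw [adjoint_inner_right, adjoint_inner_left]

theorem shift_eq_zero_iff {f : H2} : shift f = 0 ↔ f = 0 := by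
  rw [← norm_eq_zero, norm_shift, norm_eq_zero]

theorem ker_shiftSum : shiftSum.ker = ℂ ∙ (WithLp.toLp 2 (hardyBasis 0, 0) : H2sum) := by
  ext x
  change shiftSum x = 0 ↔ _
  have h : shiftSum x = 0 ↔ adjoint shift x.fst = 0 ∧ shift x.snd = 0 := by
    rw [← shiftSum_fst, ← shiftSum_snd, WithLp.ext_iff, Prod.ext_iff]
    rfl
  rw [h, adjoint_shift_eq_zero_iff, shift_eq_zero_iff, Submodule.mem_span_singleton,
    Submodule.mem_span_singleton]
  constructor
  · rintro ⟨⟨c, hc⟩, h2⟩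
    exact ⟨c, WithLp.ext_iff _ |>.2 (Prod.ext hc ((smul_zero c).trans h2.symm))⟩
  · rintro ⟨c, rfl⟩
    exact ⟨⟨c, rfl⟩, smul_zero c⟩

theorem range_shiftSum_orthogonal :
    shiftSum.rangeᗮ = ℂ ∙ (WithLp.toLp 2 (0, hardyBasis 0) : H2sum) := by
  rw [range_orthogonal_eq_ker_adjoint]
  ext x
  change adjoint shiftSum x = 0 ↔ _
  have h : adjoint shiftSum x = 0 ↔ shift x.fst = 0 ∧ adjoint shift x.snd = 0 := by
    rw [adjoint_shiftSum_apply, WithLp.ext_iff, Prod.ext_iff]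
    rfl
  rw [h, adjoint_shift_eq_zero_iff, shift_eq_zero_iff, Submodule.mem_span_singleton,
    Submodule.mem_span_singleton]
  constructor
  · rintro ⟨h1, c, hc⟩
    exact ⟨c, WithLp.ext_iff _ |>.2 (Prod.ext ((smul_zero c).trans h1.symm) hc)⟩
  · rintro ⟨c, rfl⟩
    exact ⟨smul_zero c, ⟨c, rfl⟩⟩

theorem mem_ker_shiftSum_orthogonal {x : H2sum} :
    x ∈ shiftSum.kerᗮ ↔ hardyBasis.repr x.fst 0 = 0 := by
  rw [ker_shiftSum, Submodule.mem_orthogonal_singleton_iff_inner_right, WithLp.prod_inner_apply,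
    HilbertBasis.repr_apply_apply]
  change ⟪hardyBasis 0, x.fst⟫_ℂ + ⟪0, x.snd⟫_ℂ = 0 ↔ _
  rw [inner_zero_left, add_zero]

theorem norm_shiftSum_sq (x : H2sum) :
    ‖shiftSum x‖ ^ 2 = ‖adjoint shift x.fst‖ ^ 2 + ‖x.snd‖ ^ 2 := by
  rw [WithLp.prod_norm_sq_eq_of_L2, shiftSum_fst, shiftSum_snd, norm_shift]

theorem isPartialIsometry_shiftSum : IsPartialIsometry shiftSum := by
  intro x hx
  rw [← sq_eq_sq₀ (norm_nonneg _) (norm_nonneg _), norm_shiftSum_sq,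
    norm_adjoint_shift (mem_ker_shiftSum_orthogonal.1 hx), WithLp.prod_norm_sq_eq_of_L2]

theorem isCompletelyNonUnitary_shiftSum : IsCompletelyNonUnitary shiftSum := by
  rintro M - ⟨hnorm, himage⟩
  rw [Submodule.eq_bot_iff]
  -- Isometry of the backward shift kills the Taylor coefficients of the first component.
  have hfst (n : ℕ) : ∀ x ∈ M, hardyBasis.repr x.fst n = 0 := by
    induction n with
    | zero =>
      intro x hx
      apply hardyBasis_repr_zero_of_norm_adjoint_shift
      have h := congrArg (· ^ 2) (hnorm x hx)
      simp only [norm_shiftSum_sq] at h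
      rw [WithLp.prod_norm_sq_eq_of_L2, add_left_inj] at h
      exact (sq_eq_sq₀ (norm_nonneg _) (norm_nonneg _)).1 h
    | succ n ih =>
      intro x hx
      rw [← hardyBasis_repr_adjoint_shift, ← shiftSum_fst]
      exact ih _ (himage.subset (Set.mem_image_of_mem _ hx))
  -- Surjectivity of the forward shift kills those of the second component.
  have hsnd (n : ℕ) : ∀ x ∈ M, hardyBasis.repr x.snd n = 0 := by
    induction n with
    | zero =>
      intro x hx
      obtain ⟨y, -, rfl⟩ := himage.superset hx
      rw [shiftSum_snd, hardyBasis_repr_shift_zero]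
    | succ n ih =>
      intro x hx
      obtain ⟨y, hy, rfl⟩ := himage.superset hx
      rw [shiftSum_snd, hardyBasis_repr_shift_succ, ih y hy]
  intro x hx
  refine WithLp.ext_iff _ |>.2 (Prod.ext (H2_ext fun n => ?_) (H2_ext fun n => ?_))
  · exact (hfst n x hx).trans (by simp)
  · exact (hsnd n x hx).trans (by simp)

theorem rank_span_singleton_eq_one {E : Type*} [AddCommGroup E] [Module ℂ E] {v : E}
    (hv : v ≠ 0) : Module.rank ℂ (ℂ ∙ v) = 1 :=
  (rank_submodule_eq_one_iff _).2 ⟨v, Submodule.mem_span_singleton_self v, hv, le_rfl⟩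

theorem memV_shiftSum : MemV 1 shiftSum where
  separable := by
    have : TopologicalSpace.SeparableSpace H2 := by
      rw [← TopologicalSpace.isSeparable_univ_iff]
      have h := ((Set.countable_range hardyBasis).isSeparable.span (R := ℂ)).closure
      rwa [← Submodule.topologicalClosure_coe, hardyBasis.dense_span, Submodule.top_coe] at h
    infer_instance
  partialIsometry := isPartialIsometry_shiftSum
  rank_ker := by
    rw [ker_shiftSum, Nat.cast_one]
    refine rank_span_singleton_eq_one fun h => hardyBasis.orthonormal.ne_zero 0 ?_
    exact congrArg WithLp.fst h
  rank_range_orthogonal := by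
    rw [range_shiftSum_orthogonal, Nat.cast_one]
    refine rank_span_singleton_eq_one fun h => hardyBasis.orthonormal.ne_zero 0 ?_
    exact congrArg WithLp.snd h
  completelyNonUnitary := isCompletelyNonUnitary_shiftSum

/-! ### The intertwining operator -/

section Intertwiner

variable {H : Type*} [NormedAddCommGroup H] [InnerProductSpace ℂ H]
  {T : H →L[ℂ] H}

/-- The power series `∑ ⟪u, Tⁿ x⟫ zⁿ` is in `H²` and depends boundedly on `x`. -/
theorem exists_clm_hardyBasis_repr_eq (hT : ‖T‖ ≤ 1) {u : H} (hu : ‖u‖ = 1) (hTu : T u = 0) :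
    ∃ O : H →L[ℂ] H2, ∀ x n, hardyBasis.repr (O x) n = ⟪u, (T ^ n) x⟫_ℂ := by
  have hsum (x : H) (s : Finset ℕ) : ∑ k ∈ s, ‖⟪u, (T ^ k) x⟫_ℂ‖ ^ 2 ≤ ‖x‖ ^ 2 := by
    obtain ⟨n, hn⟩ := s.exists_nat_subset_range
    have h1 := sum_norm_inner_pow_sq_le hT hu hTu x n
    have h2 : ∑ k ∈ s, ‖⟪u, (T ^ k) x⟫_ℂ‖ ^ 2 ≤
        ∑ k ∈ Finset.range n, ‖⟪u, (T ^ k) x⟫_ℂ‖ ^ 2 :=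
      Finset.sum_le_sum_of_subset_of_nonneg hn fun _ _ _ => sq_nonneg _
    nlinarith [sq_nonneg ‖(T ^ n) x‖]
  have hmem (x : H) : Memℓp (fun n : ℕ => ⟪u, (T ^ n) x⟫_ℂ) 2 :=
    memℓp_gen' (C := ‖x‖ ^ 2) fun s => by simpa using hsum x s
  let L : H →ₗ[ℂ] lp (fun _ : ℕ => ℂ) 2 :=
    { toFun x := ⟨_, hmem x⟩
      map_add' x y := by
        ext n
        exact (congrArg _ (map_add (T ^ n) x y)).trans (inner_add_right _ _ _)
      map_smul' c x := by
        ext n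
        exact (congrArg _ (map_smul (T ^ n) c x)).trans (inner_smul_right _ _ _) }
  have hL (x : H) : ‖L x‖ ≤ 1 * ‖x‖ := by
    rw [one_mul]
    refine lp.norm_le_of_forall_sum_le (by norm_num) (norm_nonneg x) fun s => ?_
    simpa [L] using hsum x s
  refine ⟨(hardyBasis.repr.symm : lp (fun _ : ℕ => ℂ) 2 →L[ℂ] H2) ∘L L.mkContinuous 1 hL,
    fun x n => ?_⟩
  simp [L]

theorem prec_shiftSum [CompleteSpace H] (hT : MemV 1 T) : PrecQ T shiftSum := by
  have hiso := hT.partialIsometry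
  obtain ⟨u, hu, hker⟩ :=
    exists_norm_eq_one_span_singleton_of_rank_eq_one (by simpa using hT.rank_ker)
  obtain ⟨w, hw, hker'⟩ :=
    exists_norm_eq_one_span_singleton_of_rank_eq_one (by simpa using hT.rank_range_orthogonal)
  rw [range_orthogonal_eq_ker_adjoint] at hker'
  have hTu : T u = 0 := by
    have : u ∈ T.ker := hker ▸ Submodule.mem_span_singleton_self u
    exact this
  have hTw : adjoint T w = 0 := by
    have : w ∈ (adjoint T).ker := hker' ▸ Submodule.mem_span_singleton_self w
    exact this
  have horth (x : H) : x ∈ T.kerᗮ ↔ ⟪u, x⟫_ℂ = 0 := by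
    rw [hker, Submodule.mem_orthogonal_singleton_iff_inner_right]
  have horth' (x : H) : x ∈ (adjoint T).kerᗮ ↔ ⟪w, x⟫_ℂ = 0 := by
    rw [hker', Submodule.mem_orthogonal_singleton_iff_inner_right]
  obtain ⟨O, hO⟩ := exists_clm_hardyBasis_repr_eq hiso.norm_le_one hu hTu
  obtain ⟨O', hO'⟩ := exists_clm_hardyBasis_repr_eq (T := adjoint T)
    (by rw [LinearIsometryEquiv.norm_map]; exact hiso.norm_le_one) hw hTw
  let X : H →L[ℂ] H2sum :=
    (WithLp.prodContinuousLinearEquiv 2 ℂ H2 H2).symm.toContinuousLinearMap ∘L O.prod O'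
  have hX₁ (x : H) : (X x).fst = O x := rfl
  have hX₂ (x : H) : (X x).snd = O' x := rfl
  refine ⟨X, (injective_iff_map_eq_zero X).2 fun x hx => ?_, fun x hx => ⟨?_, ?_⟩⟩
  · have h1 : O x = 0 := by rw [← hX₁, hx]; rfl
    have h2 : O' x = 0 := by rw [← hX₂, hx]; rfl
    refine eq_zero_of_forall_pow_mem_ker_orthogonal hiso hT.completelyNonUnitary
      (fun n => ?_) (fun n => ?_)
    · rw [horth, ← hO, h1]; simp
    · rw [horth', ← hO', h2]; simp
  · rw [mem_ker_shiftSum_orthogonal, hX₁, hO]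
    exact (horth x).1 hx
  · refine WithLp.ext_iff _ |>.2 (Prod.ext (H2_ext fun n => ?_) (H2_ext fun n => ?_))
    · change hardyBasis.repr (O (T x)) n = hardyBasis.repr (adjoint shift (O x)) n
      rw [hardyBasis_repr_adjoint_shift, hO, hO, pow_succ_apply]
    · change hardyBasis.repr (O' (T x)) n = hardyBasis.repr (shift (O' x)) n
      cases n with
      | zero =>
        rw [hardyBasis_repr_shift_zero, hO', pow_zero, one_apply_eq_self, ← adjoint_inner_left, hTw,
          inner_zero_left]
      | succ n =>
        rw [hardyBasis_repr_shift_succ, hO', hO', pow_succ_apply,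
          hiso.adjoint_apply_apply hx]

end Intertwiner

end

end PartialIsometryOrder

theorem mainTheorem4 :
    ∃ hA : PartialIsometryOrder.MemV 1 PartialIsometryOrder.shiftSum,
      (∀ c : PartialIsometryOrder.VModQ.{0} 1,
        c ≤ PartialIsometryOrder.classQ ⟨_, PartialIsometryOrder.shiftSum, hA⟩) ∧
      IsMax (PartialIsometryOrder.classQ ⟨_, PartialIsometryOrder.shiftSum, hA⟩) ∧
      (∀ c : PartialIsometryOrder.VModQ.{0} 1, IsMax c →
        c = PartialIsometryOrder.classQ ⟨_, PartialIsometryOrder.shiftSum, hA⟩) ∧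
      (∀ (H : Type*) [NormedAddCommGroup H] [InnerProductSpace ℂ H] [CompleteSpace H]
        (T : H →L[ℂ] H), PartialIsometryOrder.MemV 1 T →
          PartialIsometryOrder.PrecQ T PartialIsometryOrder.shiftSum) := by
  have htop : ∀ c : PartialIsometryOrder.VModQ.{0} 1, c ≤ PartialIsometryOrder.classQ
      ⟨_, PartialIsometryOrder.shiftSum, PartialIsometryOrder.memV_shiftSum⟩ := by
    intro c
    induction c using Quotient.inductionOn with
    | h B => exact PartialIsometryOrder.prec_shiftSum B.mem
  exact ⟨PartialIsometryOrder.memV_shiftSum, htop, fun c _ => htop c,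
    fun c hc => le_antisymm (htop c) (hc (htop c)),
    fun _ _ _ _ _ hT => PartialIsometryOrder.prec_shiftSum hT⟩
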